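/- Let $(X,\mathcal B,\mu)$ be a standard non-atomic probability space. Call a moving average a sequence of pairs $(v_n,L_n)_{n\ge 1}$ with $v_n\in\mathbb Z$, $L_n\in\mathbb Z^+$ and $(L_n)$ strictly increasing. There exists a measurable function $f:X\to\mathbb R$ such that $f\in L^p(\mu)$ for all $p<2$, $\int_X f\,d\mu=0$, and, for every invertible ergodic $\mu$-preserving transformation $T:X\to X$, there is a moving average $(v_n,L_n)$ with $L_n\ge n$ for all $n$ such that for a.e. $x\in X$, \[ \limsup_{n\to\infty}\frac1{L_n}\sum_{i=v_n+1}^{v_n+L_n} f(T^i x)>0 , \] where the limsup is taken in $[-\infty,\infty]$. In particular, for no invertible ergodic $\mu$-preserving transformation $T$ do all moving averages of $f$ with respect to $T$ converge almost everywhere. -/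

import Mathlib

open MeasureTheory Filter Topology
open scoped ENNReal

/-- The data of a moving average: integer starting points `v n` and strictly increasing positive
lengths `L n`. Sequences are indexed from `0`, so the terms usually called `v₁, L₁` are
`v 0, L 0`. -/
structure MovingAverage where
  v : ℕ → ℤ
  L : ℕ → ℕ
  L_pos : ∀ n, 0 < L n
  L_strictMono : StrictMono L

/-- The `n`-th moving average of `f` along the orbit of `x` under the invertible map `T`:
`(1 / L n) * ∑ f (T ^ i x)`, the sum being over the integers `v n + 1 ≤ i ≤ v n + L n`.
The power is the (possibly negative) composition power in the group of bijections of `X`. -/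
noncomputable def MovingAverage.avg {X : Type*} [MeasurableSpace X] (a : MovingAverage)
    (T : X ≃ᵐ X) (f : X → ℝ) (n : ℕ) (x : X) : ℝ :=
  (1 / (a.L n : ℝ)) *
    ∑ i ∈ Finset.Icc (a.v n + 1) (a.v n + (a.L n : ℤ)), f (((T.toEquiv : Equiv.Perm X) ^ i) x)

/-- All moving averages of `f` with respect to `T` converge almost everywhere (to a finite
limit, which is allowed to depend on the moving average and on the point). -/
def UniversallyConvergent {X : Type*} [MeasurableSpace X] (μ : Measure X)
    (T : X ≃ᵐ X) (f : X → ℝ) : Prop :=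
  ∀ a : MovingAverage, ∀ᵐ x ∂μ, ∃ l : ℝ, Tendsto (fun n => a.avg T f n x) atTop (𝓝 l)

/-! ### A converse Borel–Cantelli lemma for ergodic maps, with freely chosen shifts. -/

section Ergodic

variable {X : Type*} [MeasurableSpace X] {μ : Measure X} [IsProbabilityMeasure μ] {T : X → X}

/-! Take `f = g - ∫ g` with `g ≥ 0` of tail `t⁻²`, which just fails to be in `L²`. With `C = ∫ g +
1`, let `A n` be the set where `n + 1` consecutive values of `g` sum to at least `C (n + 1)`. For
independent values one large term alone would give measure of order `1 / n`. For every
measure-preserving map the sum of these measures still diverges (`sq_mul_measure_le_tsum`).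
Ergodicity then allows shifts `w n` such that almost every orbit has `T^[w n] x ∈ A n` infinitely
often (`Ergodic.exists_ae_frequently_iterate_mem`), so averages of `f` started at `w n` are at least
`1` infinitely often. Convergence would contradict Fatou, since the averages of `g` all have
integral `∫ g`. -/

theorem Ergodic.tendsto_average_measureReal_inter (hT : Ergodic T μ) {A : Set X}
    (hA : MeasurableSet A) :
    ∃ c : ℝ, ∀ B : Set X, MeasurableSet B →
      Tendsto (fun N : ℕ => (N : ℝ)⁻¹ * ∑ n ∈ Finset.range N, μ.real (B ∩ T^[n] ⁻¹' A)) atTop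
        (𝓝 (c * μ.real B)) := by
  let U : Lp ℝ 2 μ →ₗᵢ[ℝ] Lp ℝ 2 μ := Lp.compMeasurePreservingₗᵢ ℝ T hT.toMeasurePreserving
  let a : Lp ℝ 2 μ := indicatorConstLp 2 hA (measure_ne_top μ A) (1 : ℝ)
  have hlim := U.toContinuousLinearMap.tendsto_birkhoffAverage_orthogonalProjection
    U.norm_toContinuousLinearMap_le a
  set z := (U.toContinuousLinearMap.eqLocus
    (1 : Lp ℝ 2 μ →L[ℝ] Lp ℝ 2 μ)).orthogonalProjectionOnto a
  -- The mean ergodic limit is Koopman-invariant, hence constant by ergodicity.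
  have hfix : U (z : Lp ℝ 2 μ) = z := z.2
  have hcomp : ((z : Lp ℝ 2 μ) : X → ℝ) ∘ T =ᵐ[μ] (z : Lp ℝ 2 μ) :=
    (Lp.coeFn_compMeasurePreserving (z : Lp ℝ 2 μ) hT.toMeasurePreserving).symm.trans
      (Eventually.of_forall fun x => congrFun (congrArg (fun w : Lp ℝ 2 μ => (w : X → ℝ)) hfix) x)
  obtain ⟨c, hc⟩ := hT.ae_eq_const_of_ae_eq_comp_ae (Lp.aestronglyMeasurable _) hcomp
  refine ⟨c, fun B hB => ?_⟩
  let b : Lp ℝ 2 μ := indicatorConstLp 2 hB (measure_ne_top μ B) (1 : ℝ)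
  have hin := ((innerSL ℝ b).continuous.tendsto (z : Lp ℝ 2 μ)).comp hlim
  have hbz : innerSL ℝ b (z : Lp ℝ 2 μ) = c * μ.real B := by
    rw [innerSL_apply_apply, L2.inner_indicatorConstLp_one hB (measure_ne_top μ B),
      setIntegral_congr_ae (g := fun _ => c) hB (hc.mono fun x hx _ => hx)]
    simp [mul_comm]
  rw [hbz] at hin
  refine hin.congr fun N => ?_
  have hiter : ∀ n : ℕ, U^[n] a = indicatorConstLp 2 ((hT.toMeasurePreserving.iterate n).measurable hA)
      (measure_ne_top μ _) (1 : ℝ) := by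
    intro n
    have := congrFun (Lp.compMeasurePreserving_iterate (E := ℝ) (p := 2) hT.toMeasurePreserving n) a
    refine Eq.trans this ?_
    exact Lp.indicatorConstLp_compMeasurePreserving hA (measure_ne_top μ A) 1
      (hT.toMeasurePreserving.iterate n)
  simp only [Function.comp_apply, birkhoffAverage, birkhoffSum, map_smul, map_sum, id, smul_eq_mul]
  congr 1
  refine Finset.sum_congr rfl fun n _ => ?_
  have : (U.toContinuousLinearMap : Lp ℝ 2 μ → Lp ℝ 2 μ)^[n] a = U^[n] a := rfl
  rw [this, hiter, innerSL_apply_apply, L2.inner_indicatorConstLp_indicatorConstLp]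
  simp

/-- The Cesàro means of the right side tend to `μ A * μ B`, so not every term can stay below half of
it. -/
theorem Ergodic.exists_half_mul_le_measureReal_inter (hT : Ergodic T μ) {A B : Set X}
    (hA : MeasurableSet A) (hB : MeasurableSet B) :
    ∃ n : ℕ, μ.real A / 2 * μ.real B ≤ μ.real (B ∩ T^[n] ⁻¹' A) := by
  obtain ⟨c, hc⟩ := hT.tendsto_average_measureReal_inter hA
  have hcA : c = μ.real A := by
    have h := hc Set.univ MeasurableSet.univ
    refine tendsto_nhds_unique (by simpa using h)
      (tendsto_const_nhds.congr' ((eventually_gt_atTop 0).mono fun N hN => ?_))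
    have : (N : ℝ) ≠ 0 := by positivity
    have h2 : ∀ n, μ.real (T^[n] ⁻¹' A) = μ.real A := fun n =>
      (hT.toMeasurePreserving.iterate n).measureReal_preimage hA.nullMeasurableSet
    simp [h2, this]
  subst hcA
  by_contra! hlt
  have hle : μ.real A * μ.real B ≤ μ.real A / 2 * μ.real B := by
    refine le_of_tendsto (hc B hB) ((eventually_gt_atTop 0).mono fun N hN => ?_)
    have hN' : (0 : ℝ) < N := by positivity
    rw [inv_mul_le_iff₀ hN']
    refine (Finset.sum_le_sum fun n _ => (hlt n).le).trans (by simp)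
  have h0 := hlt 0
  have h1 : 0 ≤ μ.real (B ∩ T^[0] ⁻¹' A) := measureReal_nonneg
  linarith

/-- Greedy choice: each new shift removes at least the proportion `μ (A j) / 2` of the points that
have missed so far, and `1 - t ≤ exp (-t)`. -/
theorem Ergodic.exists_measureReal_forall_notMem_le_exp (hT : Ergodic T μ) {A : ℕ → Set X}
    (hA : ∀ n, MeasurableSet (A n)) (m k : ℕ) :
    ∃ v : ℕ → ℕ, μ.real {x | ∀ j ∈ Finset.Ico m (m + k), T^[v j] x ∉ A j} ≤
      Real.exp (-(∑ j ∈ Finset.Ico m (m + k), μ.real (A j)) / 2) := by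
  induction k with
  | zero => exact ⟨0, by simp⟩
  | succ k ih =>
    obtain ⟨v, hv⟩ := ih
    set B := {x | ∀ j ∈ Finset.Ico m (m + k), T^[v j] x ∉ A j} with hBdef
    have hB : MeasurableSet B := by
      have : B = ⋂ j ∈ Finset.Ico m (m + k), (T^[v j] ⁻¹' A j)ᶜ := by
        ext x; simp [hBdef]
      rw [this]
      exact Finset.measurableSet_biInter _ fun j _ =>
        ((hT.measurable.iterate (v j)) (hA j)).compl
    obtain ⟨n, hn⟩ := hT.exists_half_mul_le_measureReal_inter (hA (m + k)) hB
    refine ⟨Function.update v (m + k) n, ?_⟩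
    have hset : {x | ∀ j ∈ Finset.Ico m (m + (k + 1)),
        T^[Function.update v (m + k) n j] x ∉ A j} ⊆ B \ (T^[n] ⁻¹' A (m + k)) := by
      intro x hx
      refine ⟨fun j hj => ?_, ?_⟩
      · have h := hx j (by simp at hj ⊢; omega)
        rwa [Function.update_of_ne (by simp at hj; omega)] at h
      · simpa using hx (m + k) (by simp)
    have hdiff : μ.real (B \ (T^[n] ⁻¹' A (m + k))) =
        μ.real B - μ.real (B ∩ T^[n] ⁻¹' A (m + k)) := by
      have := measureReal_inter_add_sdiff (μ := μ) (s := B)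
        ((hT.measurable.iterate n) (hA (m + k)))
      linarith
    calc _ ≤ μ.real (B \ (T^[n] ⁻¹' A (m + k))) := measureReal_mono hset
      _ ≤ μ.real B * (-(μ.real (A (m + k)) / 2) + 1) := by rw [hdiff]; linarith
      _ ≤ μ.real B * Real.exp (-(μ.real (A (m + k)) / 2)) := by
        gcongr; exact Real.add_one_le_exp _
      _ ≤ _ := by
        refine (mul_le_mul_of_nonneg_right hv (Real.exp_nonneg _)).trans_eq ?_
        rw [← Real.exp_add, ← add_assoc, Finset.sum_Ico_succ_top (by omega)]
        congr 1; ring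

/-- If the measures of the sets `A n` have infinite sum, then the orbits under an ergodic map can
be shifted so that almost every point visits infinitely many of them. -/
theorem Ergodic.exists_ae_frequently_iterate_mem (hT : Ergodic T μ) {A : ℕ → Set X}
    (hA : ∀ n, MeasurableSet (A n)) (hsum : ¬ Summable fun n => μ.real (A n)) :
    ∃ v : ℕ → ℕ, ∀ᵐ x ∂μ, ∃ᶠ n in atTop, T^[v n] x ∈ A n := by
  have hdiv := (not_summable_iff_tendsto_nat_atTop_of_nonneg
    (fun n => measureReal_nonneg (μ := μ) (s := A n))).1 hsum
  have hblock : ∀ m i : ℕ, ∃ b : ℕ, ∃ v : ℕ → ℕ, m < b ∧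
      μ.real {x | ∀ j ∈ Finset.Ico m b, T^[v j] x ∉ A j} ≤ (1 / 2) ^ i := by
    intro m i
    have hexp : Tendsto (fun b : ℕ => Real.exp
        (-(∑ j ∈ Finset.range b, μ.real (A j) - ∑ j ∈ Finset.range m, μ.real (A j)) / 2))
        atTop (𝓝 0) := by
      refine Real.tendsto_exp_neg_atTop_nhds_zero.comp
        ((tendsto_atTop_add_const_right _ (-∑ j ∈ Finset.range m, μ.real (A j))
          hdiv).atTop_div_const (show (0 : ℝ) < 2 by norm_num)) |>.congr fun b => ?_
      simp only [Function.comp_apply]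
      congr 1; ring
    obtain ⟨b, hb, hmb⟩ := ((hexp.eventually_le_const
      (show (0 : ℝ) < (1 / 2) ^ i by positivity)).and (eventually_gt_atTop m)).exists
    obtain ⟨k, rfl⟩ := Nat.exists_eq_add_of_le hmb.le
    obtain ⟨v, hv⟩ := hT.exists_measureReal_forall_notMem_le_exp hA m k
    refine ⟨m + k, v, hmb, hv.trans ?_⟩
    rwa [Finset.sum_Ico_eq_sub _ (by omega)]
  choose b w hlt hw using hblock
  -- Consecutive blocks, the `i`-th missed with probability at most `2⁻ⁱ`; Borel–Cantelli then
  -- applies to the misses.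
  let N : ℕ → ℕ := fun i => Nat.rec 0 (fun i m => b m i) i
  have hN : ∀ i, N (i + 1) = b (N i) i := fun i => rfl
  have hmono : StrictMono N := strictMono_nat_of_lt_succ fun i => by rw [hN]; exact hlt _ _
  have hv : ∃ v : ℕ → ℕ, ∀ i, ∀ j ∈ Finset.Ico (N i) (N (i + 1)), v j = w (N i) i j := by
    have : ∀ j, ∃ r, ∀ i, j ∈ Finset.Ico (N i) (N (i + 1)) → r = w (N i) i j := by
      intro j
      by_cases h : ∃ i, j ∈ Finset.Ico (N i) (N (i + 1))
      · obtain ⟨i, hi⟩ := h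
        refine ⟨w (N i) i j, fun i' hi' => ?_⟩
        have : i = i' := by
          by_contra hne
          have hd : Disjoint (Set.Ico (N i) (N (i + 1))) (Set.Ico (N i') (N (i' + 1))) :=
            hmono.monotone.pairwise_disjoint_on_Ico_succ hne
          exact Set.disjoint_left.1 hd (Finset.mem_Ico.1 hi) (Finset.mem_Ico.1 hi')
        rw [this]
      · exact ⟨0, fun i hi => (h ⟨i, hi⟩).elim⟩
    choose v hv using this
    exact ⟨v, fun i j hj => hv j i hj⟩
  obtain ⟨v, hv⟩ := hv
  refine ⟨v, ?_⟩
  let E : ℕ → Set X := fun i => {x | ∀ j ∈ Finset.Ico (N i) (N (i + 1)), T^[v j] x ∉ A j}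
  have hE : ∀ i, μ (E i) ≤ ENNReal.ofReal ((1 / 2) ^ i) := by
    intro i
    rw [← ENNReal.ofReal_toReal (measure_ne_top μ (E i))]
    refine ENNReal.ofReal_le_ofReal ?_
    refine le_trans (le_of_eq ?_) (hw (N i) i)
    refine congrArg (fun s => (μ s).toReal) ?_
    ext x
    refine forall₂_congr fun j hj => ?_
    rw [hv i j hj]
  have hfin : ∑' i, μ (E i) ≠ ∞ := by
    refine ne_top_of_le_ne_top ?_ (ENNReal.tsum_le_tsum hE)
    rw [← ENNReal.ofReal_tsum_of_nonneg (fun i => by positivity) summable_geometric_two]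
    exact ENNReal.ofReal_ne_top
  filter_upwards [ae_eventually_notMem hfin] with x hx
  rw [frequently_atTop]
  intro n
  obtain ⟨i, hi, hni⟩ := (hx.and (eventually_ge_atTop n)).exists
  simp only [E, Set.mem_ofPred_eq, not_forall, not_not] at hi
  obtain ⟨j, hj, hjA⟩ := hi
  exact ⟨j, hni.trans ((hmono.le_apply).trans (Finset.mem_Ico.1 hj).1), hjA⟩

end Ergodic

/-! ### Divergence of the measures of large orbit sums. -/

section Counting

variable {X : Type*} [MeasurableSpace X] {μ : Measure X} {T : X → X}

theorem measurable_sum_iterate_succ {g : X → ℝ} (hg : Measurable g) (hT : Measurable T) (n : ℕ) :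
    Measurable fun x => ∑ i ∈ Finset.range n, g (T^[i + 1] x) :=
  Finset.measurable_sum _ fun i _ => hg.comp (hT.iterate (i + 1))

open Classical in
/-- The lengths `n > m` for which an orbit segment of `g` has large average are at least as many, in
the mean, as for independent variables: clustering of the visits to `{2 * m * C ≤ g}` during the
first `m` steps is compensated by the longer segments that see the whole cluster. -/
theorem MeasureTheory.MeasurePreserving.sq_mul_measure_le_tsum (hT : MeasurePreserving T μ μ)
    {g : X → ℝ} (hg : Measurable g) (hg0 : ∀ x, 0 ≤ g x) {C : ℝ} (hC : 0 ≤ C) (m : ℕ) :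
    (m : ℝ≥0∞) * m * μ {x | 2 * m * C ≤ g x} ≤
      ∑' n : ℕ, μ {x | C * ((n + m + 1 : ℕ) : ℝ) ≤
        ∑ i ∈ Finset.range (n + m + 1), g (T^[i + 1] x)} := by
  set E := {x | 2 * m * C ≤ g x}
  have hE : MeasurableSet E := measurableSet_le measurable_const hg
  set D : ℕ → Set X := fun n => {x | C * ((n + m + 1 : ℕ) : ℝ) ≤
        ∑ i ∈ Finset.range (n + m + 1), g (T^[i + 1] x)}
  have hD : ∀ n, MeasurableSet (D n) := fun n =>
    measurableSet_le measurable_const (measurable_sum_iterate_succ hg hT.measurable _)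
  have hleft : (m : ℝ≥0∞) * m * μ E =
      ∫⁻ x, m * ∑ i ∈ Finset.range m, (T^[i + 1] ⁻¹' E).indicator 1 x ∂μ := by
    have hmeas : ∀ i : ℕ, Measurable ((T^[i + 1] ⁻¹' E).indicator (1 : X → ℝ≥0∞)) := fun i =>
      measurable_one.indicator ((hT.measurable.iterate _) hE)
    rw [lintegral_const_mul _ (Finset.measurable_sum _ fun i _ => hmeas i),
      lintegral_finsetSum _ fun i _ => hmeas i, mul_assoc]
    congr 1
    rw [Finset.sum_congr rfl fun i _ => ?_, Finset.sum_const, Finset.card_range, nsmul_eq_mul]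
    rw [lintegral_indicator_one ((hT.measurable.iterate _) hE),
      (hT.iterate (i + 1)).measure_preimage hE.nullMeasurableSet]
  have hright : ∑' n, μ (D n) = ∫⁻ x, ∑' n, (D n).indicator 1 x ∂μ := by
    rw [lintegral_tsum fun n => (measurable_one.indicator (hD n)).aemeasurable]
    exact tsum_congr fun n => (lintegral_indicator_one (hD n)).symm
  rw [hleft, hright]
  refine lintegral_mono fun x => ?_
  set V := (Finset.range m).filter fun i => T^[i + 1] x ∈ E with hV
  have hcount : ∑ i ∈ Finset.range m, (T^[i + 1] ⁻¹' E).indicator (1 : X → ℝ≥0∞) x = V.card := by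
    simp only [Set.indicator_apply, Set.mem_preimage, Pi.one_apply, Finset.sum_boole, hV]
  -- The visits alone contribute `2 * m * C * V.card`, enough for every length from `m + 1` to `2 *
  -- m * V.card`. If `V` is nonempty, these are at least `m * V.card` lengths.
  have hmem : ∀ n ∈ Finset.range (2 * m * V.card - m), x ∈ D n := by
    intro n hn
    have hn' : n + m + 1 ≤ 2 * m * V.card := by simp at hn; omega
    calc C * ((n + m + 1 : ℕ) : ℝ) ≤ C * ((2 * m * V.card : ℕ) : ℝ) := by gcongr
      _ = ∑ i ∈ V, 2 * m * C := by simp; ring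
      _ ≤ ∑ i ∈ V, g (T^[i + 1] x) :=
        Finset.sum_le_sum fun i hi => (Finset.mem_filter.1 hi).2
      _ ≤ _ := Finset.sum_le_sum_of_subset_of_nonneg
        (fun i hi => by
          have := Finset.mem_range.1 (Finset.mem_filter.1 hi).1
          simp; omega) fun i _ _ => hg0 _
  have hcard : m * V.card ≤ 2 * m * V.card - m := by
    rcases Nat.eq_zero_or_pos V.card with h | h
    · simp [h]
    · have : m * 1 ≤ m * V.card := Nat.mul_le_mul_left m h
      rw [mul_assoc 2 m]; omega
  calc (m : ℝ≥0∞) * ∑ i ∈ Finset.range m, (T^[i + 1] ⁻¹' E).indicator 1 x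
      = ((m * V.card : ℕ) : ℝ≥0∞) := by rw [hcount]; push_cast; rfl
    _ ≤ ((2 * m * V.card - m : ℕ) : ℝ≥0∞) := by exact_mod_cast hcard
    _ = ∑ n ∈ Finset.range (2 * m * V.card - m), (D n).indicator 1 x := by
      rw [Finset.sum_congr rfl fun n hn => Set.indicator_of_mem (hmem n hn) 1]; simp
    _ ≤ _ := ENNReal.sum_le_tsum _

/-- The tail of the series from `m` on is at least `m² (2mC)⁻² = 1 / (4C²)`, independently of `m`,
so it cannot tend to `0`. -/
theorem MeasureTheory.MeasurePreserving.not_summable_measureReal_sum_iterate_ge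
    [IsProbabilityMeasure μ] (hT : MeasurePreserving T μ μ)
    {g : X → ℝ} (hg : Measurable g) (hg0 : ∀ x, 0 ≤ g x) {C : ℝ} (hC : 1 ≤ C)
    (htail : ∀ t : ℝ, 1 ≤ t → ENNReal.ofReal (t ^ 2)⁻¹ ≤ μ {x | t ≤ g x}) :
    ¬ Summable fun n : ℕ => μ.real {x | C * ((n + 1 : ℕ) : ℝ) ≤
        ∑ i ∈ Finset.range (n + 1), g (T^[i + 1] x)} := by
  intro hs
  set A : ℕ → Set X := fun n => {x | C * ((n + 1 : ℕ) : ℝ) ≤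
        ∑ i ∈ Finset.range (n + 1), g (T^[i + 1] x)}
  have hfin : ∑' n, μ (A n) ≠ ∞ := by
    have : ∀ n, μ (A n) = ENNReal.ofReal (μ.real (A n)) := fun n => by simp
    rw [tsum_congr this, ← ENNReal.ofReal_tsum_of_nonneg (fun n => measureReal_nonneg) hs]
    exact ENNReal.ofReal_ne_top
  have hC0 : 0 < C := by linarith
  have hlow : ∀ m : ℕ, 1 ≤ m → ENNReal.ofReal ((4 * C ^ 2)⁻¹) ≤ ∑' n, μ (A (n + m)) := by
    intro m hm
    have hm' : (1 : ℝ) ≤ m := by exact_mod_cast hm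
    refine le_trans ?_ (hT.sq_mul_measure_le_tsum hg hg0 hC0.le m)
    refine le_trans ?_ (mul_le_mul_right (htail (2 * m * C) (by nlinarith)) _)
    rw [← ENNReal.ofReal_natCast, ← ENNReal.ofReal_mul (by positivity),
      ← ENNReal.ofReal_mul (by positivity)]
    refine ENNReal.ofReal_le_ofReal (le_of_eq ?_)
    field_simp; norm_num
  have hle := ge_of_tendsto (ENNReal.tendsto_sum_nat_add _ hfin)
    ((eventually_ge_atTop 1).mono hlow)
  have : 0 < ENNReal.ofReal ((4 * C ^ 2)⁻¹) := ENNReal.ofReal_pos.2 (by positivity)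
  exact this.not_ge hle

end Counting

/-! ### A uniform variable and a function with inverse-square tail. -/

section Uniform

open ProbabilityTheory

theorem ProbabilityTheory.map_cdf_eq_volume_restrict (ν : Measure ℝ) [IsProbabilityMeasure ν]
    [NullSingletonClass ν] : ν.map (cdf ν) = volume.restrict (Set.Icc 0 1) := by
  have hmeas : Measurable (cdf ν) := (monotone_cdf ν).measurable
  have hcont : Continuous (cdf ν) := by
    refine continuous_iff_continuousAt.2 fun x => continuousAt_iff_continuous_left'_right'.2
      ⟨(monotone_cdf ν).continuousWithinAt_Iio_iff_leftLim_eq.2 ?_,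
        ((cdf ν).right_continuous x).mono Set.Ioi_subset_Ici_self⟩
    have h := (cdf ν).measure_singleton x
    rw [measure_cdf, measure_singleton, eq_comm, ENNReal.ofReal_eq_zero] at h
    exact le_antisymm ((monotone_cdf ν).leftLim_le le_rfl) (by linarith)
  have : IsProbabilityMeasure (ν.map (cdf ν)) := Measure.isProbabilityMeasure_map hmeas.aemeasurable
  refine Measure.ext_of_Iic _ _ fun t => ?_
  rw [Measure.map_apply hmeas measurableSet_Iic, Measure.restrict_apply measurableSet_Iic]
  have hval : ∀ s : ℝ, 0 < s → s < 1 → ∃ a, cdf ν a = s := by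
    intro s h0 h1
    obtain ⟨a, ha⟩ := ((tendsto_cdf_atBot ν).eventually_lt_const h0).exists
    obtain ⟨b, hb⟩ := ((tendsto_cdf_atTop ν).eventually_const_lt h1).exists
    exact mem_range_of_exists_le_of_exists_ge hcont ⟨a, ha.le⟩ ⟨b, hb.le⟩
  rcases lt_or_ge t 0 with ht | ht
  · have h1 : cdf ν ⁻¹' Set.Iic t = ∅ := by
      ext x; simpa using ht.trans_le (cdf_nonneg ν x)
    have h2 : Set.Iic t ∩ Set.Icc 0 1 = ∅ := by
      ext x; simp; intro h h'; linarith
    simp [h1, h2]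
  rcases le_or_gt 1 t with ht1 | ht1
  · have h1 : cdf ν ⁻¹' Set.Iic t = Set.univ := by
      ext x; simpa using (cdf_le_one ν x).trans ht1
    have h2 : Set.Iic t ∩ Set.Icc 0 1 = Set.Icc (0 : ℝ) 1 :=
      Set.inter_eq_right.2 fun x hx => hx.2.trans ht1
    simp [h1, h2]
  have h2 : Set.Iic t ∩ Set.Icc 0 1 = Set.Icc (0 : ℝ) t := by
    ext x; simp only [Set.mem_inter_iff, Set.mem_Iic, Set.mem_Icc]
    constructor
    · rintro ⟨h, h', -⟩; exact ⟨h', h⟩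
    · rintro ⟨h, h'⟩; exact ⟨h', h, h'.trans ht1.le⟩
  rw [h2, Real.volume_Icc, sub_zero]
  refine le_antisymm ?_ ?_
  -- The cdf may be flat at level `t`, so the bound goes through values `s > t`.
  · have hub : ∀ᶠ s in 𝓝[>] t, ν (cdf ν ⁻¹' Set.Iic t) ≤ ENNReal.ofReal s := by
      filter_upwards [Ioo_mem_nhdsGT ht1] with s hs
      obtain ⟨a, ha⟩ := hval s (ht.trans_lt hs.1) hs.2
      rw [← ha, ofReal_cdf]
      refine measure_mono fun x hx => ?_
      by_contra hxa
      have := monotone_cdf ν (not_le.1 hxa).le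
      have hx' : cdf ν x ≤ t := hx
      linarith [hs.1]
    exact ge_of_tendsto
      ((ENNReal.continuous_ofReal.tendsto t).mono_left nhdsWithin_le_nhds) hub
  · rcases ht.eq_or_lt with rfl | ht0
    · simp
    obtain ⟨a, ha⟩ := hval t ht0 ht1
    rw [← ha, ofReal_cdf]
    exact measure_mono fun x hx => monotone_cdf ν hx

theorem exists_measurable_map_eq_volume_restrict {X : Type*} [MeasurableSpace X]
    [StandardBorelSpace X] (μ : Measure X) [IsProbabilityMeasure μ] [NullSingletonClass μ] :
    ∃ U : X → ℝ, Measurable U ∧ μ.map U = volume.restrict (Set.Icc 0 1) := by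
  have he := measurableEmbedding_embeddingReal X
  have : IsProbabilityMeasure (μ.map (embeddingReal X)) :=
    Measure.isProbabilityMeasure_map he.measurable.aemeasurable
  have : NullSingletonClass (μ.map (embeddingReal X)) := ⟨fun y => by
    rw [he.map_apply]
    refine Set.Subsingleton.measure_zero (fun a ha b hb => he.injective ?_) μ
    exact Eq.trans ha (Eq.symm hb)⟩
  have hm : Measurable (cdf (μ.map (embeddingReal X))) := (monotone_cdf _).measurable
  refine ⟨cdf (μ.map (embeddingReal X)) ∘ embeddingReal X, hm.comp he.measurable, ?_⟩
  rw [← Measure.map_map hm he.measurable, map_cdf_eq_volume_restrict]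

/-- A nonatomic standard probability space carries a function with tail exactly `t⁻²`, hence in
`L^p` for every `p < 2`. -/
theorem exists_memLp_lt_two_inv_sq_le_measure {X : Type*} [MeasurableSpace X]
    [StandardBorelSpace X] (μ : Measure X) [IsProbabilityMeasure μ] [NullSingletonClass μ] :
    ∃ g : X → ℝ, Measurable g ∧ (∀ x, 0 ≤ g x) ∧ (∀ p : ℝ≥0∞, p < 2 → MemLp g p μ) ∧
      ∀ t : ℝ, 1 ≤ t → ENNReal.ofReal (t ^ 2)⁻¹ ≤ μ {x | t ≤ g x} := by
  obtain ⟨U, hU, hmap⟩ := exists_measurable_map_eq_volume_restrict μ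
  let φ : ℝ → ℝ := fun u => |u| ^ (-(1 / 2) : ℝ)
  have hφ : Measurable φ := by fun_prop
  refine ⟨φ ∘ U, hφ.comp hU, fun x => Real.rpow_nonneg (abs_nonneg _) _, ?_, ?_⟩
  · have key : ∀ q : ℝ, 0 < q → q < 2 → MemLp (φ ∘ U) (ENNReal.ofReal q) μ := by
      intro q hq hq2
      rw [← memLp_map_measure_iff hφ.aestronglyMeasurable hU.aemeasurable, hmap,
        ← integrable_norm_rpow_iff hφ.aestronglyMeasurable (by simpa using hq)
          ENNReal.ofReal_ne_top, ENNReal.toReal_ofReal hq.le]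
      have hint : IntegrableOn (fun u : ℝ => u ^ (-(q / 2))) (Set.Icc 0 1) := by
        have := intervalIntegral.intervalIntegrable_rpow' (a := 0) (b := 1)
          (show -1 < -(q / 2) by linarith)
        rwa [intervalIntegrable_iff_integrableOn_Icc_of_le zero_le_one] at this
      refine hint.congr_fun (fun u hu => ?_) measurableSet_Icc
      have hu0 : 0 ≤ u := hu.1
      simp only [φ]
      rw [Real.norm_of_nonneg (by positivity), abs_of_nonneg hu0, ← Real.rpow_mul hu0]
      congr 1; ring
    intro p hp
    have hpt : p ≠ ∞ := ne_top_of_lt hp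
    have hp2 : p.toReal < 2 := by
      have := (ENNReal.toReal_lt_toReal hpt (by simp)).2 hp
      simpa using this
    -- The maximum with `1` keeps the exponent positive when `p = 0`.
    refine (key (max 1 p.toReal) (by positivity) (max_lt (by norm_num) hp2)).mono_exponent ?_
    rw [← ENNReal.ofReal_toReal hpt]
    exact ENNReal.ofReal_le_ofReal (by simp)
  · intro t ht
    have ht0 : 0 < t := by linarith
    -- Zero is left out because `φ 0 = 0` by the convention for `rpow`.
    have hsub : U ⁻¹' Set.Ioc 0 (t ^ 2)⁻¹ ⊆ {x | t ≤ (φ ∘ U) x} := by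
      intro x hx
      have hx0 : 0 < U x := hx.1
      have hx1 : U x ≤ (t ^ 2)⁻¹ := hx.2
      change t ≤ |U x| ^ (-(1 / 2) : ℝ)
      rw [abs_of_pos hx0]
      calc t = ((t ^ 2)⁻¹) ^ (-(1 / 2) : ℝ) := by
            rw [Real.rpow_neg (by positivity), Real.inv_rpow (by positivity), inv_inv,
              ← Real.sqrt_eq_rpow, Real.sqrt_sq ht0.le]
        _ ≤ _ := Real.rpow_le_rpow_of_nonpos hx0 hx1 (by norm_num)
    refine le_trans (le_of_eq ?_) (measure_mono hsub)
    rw [← Measure.map_apply hU measurableSet_Ioc, hmap, Measure.restrict_apply measurableSet_Ioc,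
      Set.inter_eq_left.2 fun u hu => ?_, Real.volume_Ioc, sub_zero]
    exact ⟨hu.1.le, hu.2.trans (inv_le_one_of_one_le₀ (one_le_pow₀ ht))⟩

end Uniform

/-! ### Moving averages with lengths `n + 1`, and the conclusion. -/

section Main

variable {X : Type*} [MeasurableSpace X]

/-- The moving average with lengths `1, 2, 3, …` and prescribed nonnegative starting points. -/
def MovingAverage.ofStart (w : ℕ → ℕ) : MovingAverage where
  v n := w n
  L n := n + 1
  L_pos n := n.succ_pos
  L_strictMono := strictMono_nat_of_lt_succ fun _ => Nat.lt_succ_self _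

theorem MovingAverage.avg_ofStart (w : ℕ → ℕ) (T : X ≃ᵐ X) (f : X → ℝ) (n : ℕ) (x : X) :
    (MovingAverage.ofStart w).avg T f n x = (1 / ((n + 1 : ℕ) : ℝ)) *
      ∑ i ∈ Finset.range (n + 1), f (T^[i + 1] (T^[w n] x)) := by
  unfold MovingAverage.avg MovingAverage.ofStart
  congr 1
  symm
  refine Finset.sum_bij' (fun i _ => (w n : ℤ) + 1 + i) (fun k _ => (k - (w n + 1)).toNat)
    ?_ ?_ ?_ ?_ ?_
  · intro i hi; simp at hi ⊢; omega
  · intro k hk; simp at hk ⊢; omega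
  · intro i hi; simp
  · intro k hk; simp at hk ⊢; omega
  · intro i hi
    have : (w n : ℤ) + 1 + i = ((i + 1 + w n : ℕ) : ℤ) := by push_cast; ring
    rw [this, zpow_natCast, ← Function.iterate_add_apply, ← Equiv.Perm.iterate_eq_pow]
    rfl

theorem MovingAverage.avg_ofStart_sub_const (w : ℕ → ℕ) (T : X ≃ᵐ X) (g : X → ℝ) (c : ℝ) (n : ℕ)
    (x : X) : (MovingAverage.ofStart w).avg T (fun x => g x - c) n x =
      (MovingAverage.ofStart w).avg T g n x - c := by
  rw [avg_ofStart, avg_ofStart, Finset.sum_sub_distrib, mul_sub]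
  have : ((n + 1 : ℕ) : ℝ) ≠ 0 := by positivity
  simp only [Finset.sum_const, Finset.card_range, nsmul_eq_mul]
  field_simp

theorem MovingAverage.lintegral_avg_ofStart (w : ℕ → ℕ) {μ : Measure X} {T : X ≃ᵐ X}
    (hT : MeasurePreserving T μ μ) {g : X → ℝ} (hg : Measurable g) (hg0 : ∀ x, 0 ≤ g x)
    (n : ℕ) : ∫⁻ x, ENNReal.ofReal ((MovingAverage.ofStart w).avg T g n x) ∂μ =
      ∫⁻ x, ENNReal.ofReal (g x) ∂μ := by
  have hn : (0 : ℝ) < ((n + 1 : ℕ) : ℝ) := by positivity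
  have hmp : ∀ i : ℕ, MeasurePreserving (fun x => T^[i + 1] (T^[w n] x)) μ μ := fun i =>
    (hT.iterate (i + 1)).comp (hT.iterate (w n))
  have hmeas : ∀ i : ℕ, Measurable fun x => ENNReal.ofReal (g (T^[i + 1] (T^[w n] x))) := fun i =>
    (hg.comp (hmp i).measurable).ennreal_ofReal
  simp_rw [avg_ofStart, ENNReal.ofReal_mul (one_div_nonneg.2 hn.le),
    ENNReal.ofReal_sum_of_nonneg fun i _ => hg0 _]
  rw [lintegral_const_mul _ (Finset.measurable_sum _ fun i _ => hmeas i),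
    lintegral_finsetSum _ fun i _ => hmeas i,
    Finset.sum_congr rfl fun i _ => (hmp i).lintegral_comp hg.ennreal_ofReal,
    Finset.sum_const, Finset.card_range, nsmul_eq_mul, ← mul_assoc,
    ← ENNReal.ofReal_natCast, ← ENNReal.ofReal_mul (one_div_nonneg.2 hn.le),
    one_div_mul_cancel hn.ne', ENNReal.ofReal_one, one_mul]

/-- Fatou: an almost everywhere limit would be at least `∫ g + 1`, yet have integral at most `∫ g`.
-/
theorem MovingAverage.not_ae_exists_tendsto_of_frequently (w : ℕ → ℕ) {μ : Measure X}
    [IsProbabilityMeasure μ] {T : X ≃ᵐ X} (hT : MeasurePreserving T μ μ) {g : X → ℝ}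
    (hg : Measurable g) (hg0 : ∀ x, 0 ≤ g x) (hgi : Integrable g μ)
    (hfreq : ∀ᵐ x ∂μ, ∃ᶠ n in atTop, (∫ y, g y ∂μ) + 1 ≤ (MovingAverage.ofStart w).avg T g n x) :
    ¬ ∀ᵐ x ∂μ, ∃ l : ℝ,
      Tendsto (fun n => (MovingAverage.ofStart w).avg T g n x) atTop (𝓝 l) := by
  intro hconv
  have hc : 0 ≤ ∫ y, g y ∂μ := integral_nonneg hg0
  have hmeas : ∀ n, Measurable fun x =>
      ENNReal.ofReal ((MovingAverage.ofStart w).avg T g n x) := by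
    intro n
    simp_rw [avg_ofStart]
    exact (((measurable_sum_iterate_succ hg T.measurable (n + 1)).comp
      (T.measurable.iterate (w n))).const_mul _).ennreal_ofReal
  have hfatou := lintegral_liminf_le (μ := μ) (u := atTop) hmeas
  simp only [lintegral_avg_ofStart w hT hg hg0, liminf_const,
    ← ofReal_integral_eq_lintegral_ofReal hgi (Eventually.of_forall hg0)] at hfatou
  have hlow : ENNReal.ofReal ((∫ y, g y ∂μ) + 1) ≤ ∫⁻ x, liminf (fun n =>
      ENNReal.ofReal ((MovingAverage.ofStart w).avg T g n x)) atTop ∂μ := by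
    calc ENNReal.ofReal ((∫ y, g y ∂μ) + 1) = ∫⁻ _, ENNReal.ofReal ((∫ y, g y ∂μ) + 1) ∂μ := by
          simp
      _ ≤ _ := by
        refine lintegral_mono_ae ?_
        filter_upwards [hfreq, hconv] with x hx ⟨l, hl⟩
        have hlim := (ENNReal.continuous_ofReal.tendsto l).comp hl
        refine le_of_le_of_eq ?_ hlim.liminf_eq.symm
        exact ENNReal.ofReal_le_ofReal (ge_of_tendsto_of_frequently hl hx)
  have := (ENNReal.ofReal_le_ofReal_iff hc).1 (hlow.trans hfatou)
  linarith

end Main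

theorem mainTheorem2 {X : Type*} [MeasurableSpace X] [StandardBorelSpace X]
    (μ : Measure X) [IsProbabilityMeasure μ] [NullSingletonClass μ] :
    ∃ f : X → ℝ, Measurable f ∧ (∀ p : ℝ≥0∞, p < 2 → MemLp f p μ) ∧ ∫ x, f x ∂μ = 0 ∧
      ∀ T : X ≃ᵐ X, Ergodic T μ →
        (∃ a : MovingAverage, (∀ n, n + 1 ≤ a.L n) ∧
          ∀ᵐ x ∂μ, (0 : EReal) < limsup (fun n => ((a.avg T f n x : ℝ) : EReal)) atTop) ∧
        ¬ UniversallyConvergent μ T f := by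
  obtain ⟨g, hg, hg0, hgp, htail⟩ := exists_memLp_lt_two_inv_sq_le_measure μ
  have hgi : Integrable g μ := memLp_one_iff_integrable.1 (hgp 1 (by norm_num))
  set c := ∫ x, g x ∂μ with hc
  have hc0 : 0 ≤ c := integral_nonneg hg0
  refine ⟨fun x => g x - c, hg.sub_const c, fun p hp => (hgp p hp).sub (memLp_const c), ?_,
    fun T hT => ?_⟩
  · rw [integral_sub hgi (integrable_const c)]; simp [hc]
  let A : ℕ → Set X := fun n => {x | (c + 1) * ((n + 1 : ℕ) : ℝ) ≤
    ∑ i ∈ Finset.range (n + 1), g (T^[i + 1] x)}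
  have hA : ∀ n, MeasurableSet (A n) := fun n =>
    measurableSet_le measurable_const (measurable_sum_iterate_succ hg T.measurable _)
  obtain ⟨w, hw⟩ := hT.exists_ae_frequently_iterate_mem hA
    (hT.toMeasurePreserving.not_summable_measureReal_sum_iterate_ge hg hg0
      (show 1 ≤ c + 1 by linarith) htail)
  have hfreq : ∀ᵐ x ∂μ, ∃ᶠ n in atTop, c + 1 ≤ (MovingAverage.ofStart w).avg T g n x := by
    filter_upwards [hw] with x hx
    refine hx.mono fun n hn => ?_
    rw [MovingAverage.avg_ofStart, one_div, le_inv_mul_iff₀ (by positivity), mul_comm]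
    exact hn
  refine ⟨⟨MovingAverage.ofStart w, fun n => le_rfl, ?_⟩, fun hU => ?_⟩
  · filter_upwards [hfreq] with x hx
    refine (zero_lt_one (α := EReal)).trans_le (le_limsup_of_frequently_le (hx.mono fun n hn => ?_))
    rw [MovingAverage.avg_ofStart_sub_const, ← EReal.coe_one, EReal.coe_le_coe_iff]
    linarith
  · refine MovingAverage.not_ae_exists_tendsto_of_frequently w hT.toMeasurePreserving hg hg0 hgi
      hfreq ?_
    filter_upwards [hU (MovingAverage.ofStart w)] with x ⟨l, hl⟩
    refine ⟨l + c, (hl.add_const c).congr fun n => ?_⟩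
    rw [MovingAverage.avg_ofStart_sub_const, sub_add_cancel]
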